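/- Let $A$ be a bounded operator on a separable complex Hilbert space $\mathcal X$ which is a completely non-isometric contraction, that is, $\|A\|\le 1$ and $\bigcap_{n\ge 0}\{x\in\mathcal X:\|A^nx\|=\|x\|\}=\{0\}$. Then there are separable complex Hilbert spaces $\mathcal U,\mathcal Y$ and a Schur-class function $S$ (an analytic function on the open unit disk $\mathbb D$ whose values are contractions in $\mathcal L(\mathcal U,\mathcal Y)$) such that both of the following hold. (1) $A$ is unitarily equivalent to the model operator $R_0: f(z)\mapsto [f(z)-f(0)]/z$ on the de Branges–Rovnyak space $$\mathcal H(S)=\Bigl\{f\in H^2(\mathcal Y): \|f\|_{\mathcal H(S)}^2:=\sup_{g\in H^2(\mathcal U)}\bigl(\|f+Sg\|_{H^2(\mathcal Y)}^2-\|g\|_{H^2(\mathcal U)}^2\bigr)<\infty\Bigr\}.$$ In other words, there is a linear norm-preserving bijection $V$ of $\mathcal X$ onto $\mathcal H(S)$ with $VA=R_0V$. (2) $I-S^*S$ has zero maximal factorable minorant: if $\mathcal Y_0$ is a separable complex Hilbert space and $\Phi$ is a Schur-class function with values in $\mathcal L(\mathcal U,\mathcal Y_0)$ such that the (nontangential weak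 limit) boundary values satisfy $\Phi(\zeta)^*\Phi(\zeta)\le I-S(\zeta)^*S(\zeta)$ for almost every $\zeta$ on the unit circle, then $\Phi=0$. -/

import Mathlib

open Filter Topology MeasureTheory

universe u

/-- `A` is a completely non-isometric contraction: `‖A‖ ≤ 1` and
`⋂ n, {x | ‖A ^ n x‖ = ‖x‖} = {0}`. -/
def IsCompletelyNonIsometricContraction {X : Type*} [NormedAddCommGroup X]
    [InnerProductSpace ℂ X] (A : X →L[ℂ] X) : Prop :=
  ‖A‖ ≤ 1 ∧ (⋂ n : ℕ, {x : X | ‖(A ^ n) x‖ = ‖x‖}) = {0}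

/-- The Schur class: analytic functions on the open unit disk whose values are contractions
(the values of `S` off the disk are irrelevant). -/
def IsSchur {U Y : Type*} [NormedAddCommGroup U] [InnerProductSpace ℂ U]
    [NormedAddCommGroup Y] [InnerProductSpace ℂ Y] (S : ℂ → U →L[ℂ] Y) : Prop :=
  DifferentiableOn ℂ S (Metric.ball 0 1) ∧ ∀ z ∈ Metric.ball (0 : ℂ) 1, ‖S z‖ ≤ 1

/-- The Hardy space `H²(Y)`, an element being given by its square-summable sequence of Taylor
coefficients; the corresponding function on the disk is `HardySpace.eval f`. -/
abbrev HardySpace (Y : Type*) [NormedAddCommGroup Y] [InnerProductSpace ℂ Y] : Type _ :=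
  lp (fun _ : ℕ => Y) 2

namespace HardySpace

/-- The value `f(z) = ∑ₙ fₙ zⁿ` at a point `z` of the open unit disk. -/
noncomputable def eval {Y : Type*} [NormedAddCommGroup Y] [InnerProductSpace ℂ Y]
    (f : HardySpace Y) (z : ℂ) : Y :=
  ∑' n : ℕ, z ^ n • f n

/-- The series defining `eval f z` converges on the open unit disk. -/
theorem summable_eval {Y : Type*} [NormedAddCommGroup Y] [InnerProductSpace ℂ Y]
    [CompleteSpace Y] (f : HardySpace Y) {z : ℂ} (hz : z ∈ Metric.ball (0 : ℂ) 1) :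
    Summable fun n : ℕ => z ^ n • f n := by
  have hz' : ‖z‖ < 1 := by simpa using hz
  refine Summable.of_norm_bounded (g := fun n : ℕ => ‖z‖ ^ n * ‖f‖)
    ((summable_geometric_of_lt_one (norm_nonneg z) hz').mul_right _) fun n => ?_
  rw [norm_smul, norm_pow]
  exact mul_le_mul_of_nonneg_left (lp.norm_apply_le_norm (by norm_num) f n) (by positivity)

/-- The backward shift `f(z) ↦ (f(z) - f(0)) / z` on `H²(Y)`, the adjoint of the shift
`f(z) ↦ z f(z)`; on Taylor coefficients it is `(fₙ) ↦ (fₙ₊₁)`. -/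
def backwardShift (Y : Type*) [NormedAddCommGroup Y] [InnerProductSpace ℂ Y] :
    HardySpace Y →ₗ[ℂ] HardySpace Y where
  toFun f := ⟨fun n => f (n + 1), by
    have h := (memℓp_gen_iff (E := fun _ : ℕ => Y) (p := 2) (by norm_num)).1 (lp.memℓp f)
    exact (memℓp_gen_iff (by norm_num)).2 ((summable_nat_add_iff 1).2 h)⟩
  map_add' f g := rfl
  map_smul' c f := rfl

/-- In terms of functions, the backward shift is the difference quotient. -/
theorem smul_eval_backwardShift {Y : Type*} [NormedAddCommGroup Y] [InnerProductSpace ℂ Y]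
    [CompleteSpace Y] (f : HardySpace Y) {z : ℂ} (hz : z ∈ Metric.ball (0 : ℂ) 1) :
    z • eval (backwardShift Y f) z = eval f z - eval f 0 := by
  have h0 : eval f 0 = f 0 := by
    unfold eval
    rw [tsum_eq_single 0 (fun n hn => by simp [hn])]
    simp
  have h1 : eval f z = f 0 + ∑' n : ℕ, z ^ (n + 1) • f (n + 1) := by
    unfold eval
    rw [(summable_eval f hz).tsum_eq_zero_add]
    simp
  rw [h0, h1, add_sub_cancel_left]
  change z • ∑' n : ℕ, z ^ n • f (n + 1) = _
  rw [← tsum_const_smul'' z]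
  simp [pow_succ', mul_smul]

end HardySpace

section DeBrangesRovnyak

variable {U Y : Type*} [NormedAddCommGroup U] [InnerProductSpace ℂ U]
  [NormedAddCommGroup Y] [InnerProductSpace ℂ Y]

/-- The set of real numbers `‖f + S g‖² - ‖g‖²`, where `g` runs through `H²(U)` and norms are
those of `H²`; here `h` is the element `S g` of `H²(Y)`. -/
def deBrangesRovnyakValues (S : ℂ → U →L[ℂ] Y) (f : HardySpace Y) : Set ℝ :=
  {t | ∃ (g : HardySpace U) (h : HardySpace Y),
    (∀ z ∈ Metric.ball (0 : ℂ) 1, h.eval z = S z (g.eval z)) ∧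
      t = ‖f + h‖ ^ 2 - ‖g‖ ^ 2}

/-- The de Branges-Rovnyak space `H(S)`, as a set:
`f ∈ H²(Y)` belongs to it if `sup {‖f + S g‖² - ‖g‖² : g ∈ H²(U)} < ∞`. -/
def deBrangesRovnyakSpace (S : ℂ → U →L[ℂ] Y) : Set (HardySpace Y) :=
  {f | BddAbove (deBrangesRovnyakValues S f)}

/-- The norm of `H(S)`: `‖f‖² = sup {‖f + S g‖² - ‖g‖² : g ∈ H²(U)}`, for `f` in `H(S)`. -/
noncomputable def deBrangesRovnyakNorm (S : ℂ → U →L[ℂ] Y) (f : HardySpace Y) : ℝ :=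
  Real.sqrt (sSup (deBrangesRovnyakValues S f))

/-- The operator `A` on `X` is unitarily equivalent to the model operator
`R₀ : f(z) ↦ (f(z) - f(0)) / z` on `H(S)`: there is a linear isometry `V` of `X` (with its own
norm) onto `H(S)` (with the norm of `H(S)`) such that `V A = R₀ V`. -/
def IsUnitarilyEquivalentToModel {X : Type*} [NormedAddCommGroup X] [InnerProductSpace ℂ X]
    (A : X →L[ℂ] X) (S : ℂ → U →L[ℂ] Y) : Prop :=
  ∃ V : X →ₗ[ℂ] HardySpace Y,
    Set.range V = deBrangesRovnyakSpace S ∧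
    (∀ x, deBrangesRovnyakNorm S (V x) = ‖x‖) ∧
    ∀ x, V (A x) = HardySpace.backwardShift Y (V x)

/-- `W` is the boundary-value function of `F` on the unit circle (parametrized by `ζ = e^{iθ}`):
for almost every `ζ` the operators `F z` converge weakly to `W ζ` as `z → ζ` nontangentially,
i.e. within each region `{z | ‖z‖ < 1, ‖z - ζ‖ < M (1 - ‖z‖)}`. If `U` and `Y` are separable
Hilbert spaces, then every bounded analytic `F` has such a `W`, unique up to null sets. -/
def IsBoundaryFunction (F : ℂ → U →L[ℂ] Y) (W : Circle → U →L[ℂ] Y) : Prop :=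
  ∀ᵐ θ : ℝ, ∀ (M : ℝ) (u : U) (y : Y),
    Tendsto (fun z : ℂ => inner ℂ y (F z u))
      (𝓝[{z : ℂ | ‖z‖ < 1 ∧ ‖z - Circle.exp θ‖ < M * (1 - ‖z‖)}] (Circle.exp θ : ℂ))
      (𝓝 (inner ℂ y (W (Circle.exp θ) u)))

end DeBrangesRovnyak

/-- The maximal factorable minorant of `I - S*S` is zero: the only Schur-class function `Φ`, with
values in `L(U, Y₀)` for some separable Hilbert space `Y₀`, such that
`Φ(ζ)* Φ(ζ) ≤ I - S(ζ)* S(ζ)` for almost every `ζ` on the unit circle is `Φ = 0`. -/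
def HasZeroMaximalFactorableMinorant {U Y : Type u}
    [NormedAddCommGroup U] [InnerProductSpace ℂ U] [CompleteSpace U]
    [NormedAddCommGroup Y] [InnerProductSpace ℂ Y] [CompleteSpace Y]
    (S : ℂ → U →L[ℂ] Y) : Prop :=
  ∀ (Y₀ : Type u) [NormedAddCommGroup Y₀] [InnerProductSpace ℂ Y₀] [CompleteSpace Y₀]
    [TopologicalSpace.SeparableSpace Y₀]
    (Φ : ℂ → U →L[ℂ] Y₀) (Sb : Circle → U →L[ℂ] Y) (Φb : Circle → U →L[ℂ] Y₀),
    IsSchur Φ → IsBoundaryFunction S Sb → IsBoundaryFunction Φ Φb →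
    (∀ᵐ θ : ℝ,
      (Φb (Circle.exp θ)).adjoint ∘L Φb (Circle.exp θ) ≤
        ContinuousLinearMap.id ℂ U -
          (Sb (Circle.exp θ)).adjoint ∘L Sb (Circle.exp θ)) →
    ∀ z ∈ Metric.ball (0 : ℂ) 1, Φ z = 0

/-! The map `x ↦ (A x, (1 - A* A)^(1/2) x)` is an isometry of `X` into `X ⊕ X`. Taking `U` to be the
orthogonal complement of its range and `Y = X` completes it to a unitary operator from `X ⊕ U` to `X
⊕ Y` (`defectColligation`), and `S` is the transfer function of the resulting linear system.

Let `O` be the observability operator and `T` the input-output operator, which is multiplication by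
`S` (`eval_inputOutput`). Energy balance makes the row `(O T)` a contraction, and unitarity of the
colligation makes it a coisometry: `O O* + T T* = 1`. Being completely non-isometric says that `O`
is injective, so `O*` has dense range. For such a row, `sup_g (‖O x + T g‖² - ‖g‖²) = ‖x‖²`, and a
finite supremum at `f` forces `f` into the range of `O`. Hence `O` is the required unitary onto
`H(S)`, and it intertwines `A` with the backward shift.

For (2), a minorant `Φ` satisfies `‖S g‖² + ‖Φ g‖² ≤ ‖g‖²`. Suppose `Φ = zⁿ Ψ` and put `g = u + z
g'`. The coefficient of `zⁿ` in `Φ g` is `Ψ(0) u`, so `‖Ψ(0) u‖² ≤ ‖u‖² - ‖D u‖² - (‖O B u + T g'‖²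
- ‖g'‖²)`. By the supremum formula at `x = B u`, the infimum over `g'` of the right side is `‖u‖² -
‖D u‖² - ‖B u‖² = 0`. So `Ψ(0) = 0`, and inductively `Φ` vanishes to infinite order at the origin.
-/

namespace HardySpace

/-! ### The space `H²` through Taylor coefficients -/

variable {Y : Type*} [NormedAddCommGroup Y] [InnerProductSpace ℂ Y]

theorem summable_norm_sq (f : HardySpace Y) : Summable fun n => ‖f n‖ ^ 2 := by
  have h := (memℓp_gen_iff (E := fun _ : ℕ => Y) (p := 2) (by norm_num)).1 (lp.memℓp f)
  simpa using h

theorem memℓp_of_summable {E : Type*} [NormedAddCommGroup E] {f : ℕ → E} (h : Summable fun n => ‖f n‖ ^ 2) :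
    Memℓp (E := fun _ : ℕ => E) f 2 :=
  (memℓp_gen_iff (by norm_num)).2 (by simpa using h)

theorem norm_sq_eq_tsum (f : HardySpace Y) : ‖f‖ ^ 2 = ∑' n, ‖f n‖ ^ 2 := by
  have h := lp.norm_rpow_eq_tsum (p := 2) (by norm_num) f
  simpa using h

/-- The element of `H²` with constant coefficient `y` and backward shift `f`. -/
def cons (y : Y) (f : HardySpace Y) : HardySpace Y :=
  ⟨fun n => Nat.casesOn n y fun k => f k, by
    refine memℓp_of_summable ((summable_nat_add_iff 1).1 ?_)
    exact summable_norm_sq f⟩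

@[simp]
theorem cons_apply_zero (y : Y) (f : HardySpace Y) : cons y f 0 = y := rfl

@[simp]
theorem cons_apply_succ (y : Y) (f : HardySpace Y) (n : ℕ) : cons y f (n + 1) = f n := rfl

@[simp]
theorem backwardShift_apply (f : HardySpace Y) (n : ℕ) : backwardShift Y f n = f (n + 1) := rfl

@[ext]
theorem ext {f g : HardySpace Y} (h : ∀ n, f n = g n) : f = g :=
  lp.ext (funext h)

@[simp]
theorem backwardShift_cons (y : Y) (f : HardySpace Y) : backwardShift Y (cons y f) = f :=
  ext fun _ => rfl

theorem cons_backwardShift (f : HardySpace Y) : cons (f 0) (backwardShift Y f) = f := by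
  ext n
  cases n <;> rfl

theorem norm_cons_sq (y : Y) (f : HardySpace Y) : ‖cons y f‖ ^ 2 = ‖y‖ ^ 2 + ‖f‖ ^ 2 := by
  rw [norm_sq_eq_tsum, norm_sq_eq_tsum f, (summable_norm_sq (cons y f)).tsum_eq_zero_add]
  simp only [cons_apply_zero, cons_apply_succ]

theorem inner_cons_left (y : Y) (f h : HardySpace Y) :
    inner ℂ (cons y f) h = inner ℂ y (h 0) + inner ℂ f (backwardShift Y h) := by
  have hs := lp.summable_inner (𝕜 := ℂ) (G := fun _ : ℕ => Y) (cons y f) h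
  rw [lp.inner_eq_tsum, lp.inner_eq_tsum, hs.tsum_eq_zero_add]
  simp only [cons_apply_zero, cons_apply_succ, backwardShift_apply]

theorem sum_norm_sq_le (f : HardySpace Y) (N : ℕ) :
    ∑ n ∈ Finset.range N, ‖f n‖ ^ 2 ≤ ‖f‖ ^ 2 := by
  rw [norm_sq_eq_tsum]
  exact (summable_norm_sq f).sum_le_tsum _ fun _ _ => by positivity

theorem summable_norm_eval (f : HardySpace Y) {z : ℂ} (hz : ‖z‖ < 1) :
    Summable fun n : ℕ => ‖z ^ n • f n‖ := by
  refine Summable.of_nonneg_of_le (fun _ => norm_nonneg _) (fun n => ?_)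
    ((summable_geometric_of_lt_one (norm_nonneg z) hz).mul_right ‖f‖)
  rw [norm_smul, norm_pow]
  exact mul_le_mul_of_nonneg_left (lp.norm_apply_le_norm (by norm_num) f n) (by positivity)

theorem eval_zero (f : HardySpace Y) : eval f 0 = f 0 := by
  unfold eval
  rw [tsum_eq_single 0 (fun n hn => by simp [hn])]
  simp

theorem continuousAt_eval_zero [CompleteSpace Y] (f : HardySpace Y) : ContinuousAt (eval f) 0 := by
  have h : ContinuousOn (eval f) (Metric.closedBall 0 (1 / 2)) := by
    refine continuousOn_tsum (u := fun n : ℕ => (1 / 2 : ℝ) ^ n * ‖f‖) (fun n => by fun_prop)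
      ((summable_geometric_of_lt_one (by norm_num) (by norm_num)).mul_right _) fun n z hz => ?_
    rw [norm_smul, norm_pow]
    have hz' : ‖z‖ ≤ 1 / 2 := by simpa using hz
    have := lp.norm_apply_le_norm (by norm_num) f n
    gcongr
  exact h.continuousAt (Metric.closedBall_mem_nhds _ (by norm_num))

/-- An element of `H²` is determined by the corresponding function on the disk. -/
theorem eval_injOn [CompleteSpace Y] {f g : HardySpace Y}
    (h : ∀ z ∈ Metric.ball (0 : ℂ) 1, eval f z = eval g z) : f = g := by
  -- Quantifying over `f` and `g` lets the induction pass to their backward shifts.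
  have key : ∀ (n : ℕ) (f g : HardySpace Y),
      (∀ z ∈ Metric.ball (0 : ℂ) 1, eval f z = eval g z) → f n = g n := by
    intro n
    induction n with
    | zero =>
      intro f g h
      simpa [eval_zero] using h 0 (by simp)
    | succ n ih =>
      intro f g h
      have hne : ∀ z ∈ Metric.ball (0 : ℂ) 1, z ≠ 0 →
          eval (backwardShift Y f) z = eval (backwardShift Y g) z := by
        intro z hz hz0
        refine smul_right_injective Y hz0 ?_
        simp only [smul_eval_backwardShift _ hz, h z hz, h 0 (by simp)]
      refine ih (backwardShift Y f) (backwardShift Y g) fun z hz => ?_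
      -- The difference quotient says nothing at the origin; continuity fills in that point.
      by_cases hz0 : z = 0
      · subst hz0
        have h1 := (continuousAt_eval_zero (backwardShift Y f)).tendsto.mono_left
          (nhdsWithin_le_nhds (s := {0}ᶜ))
        have h2 := (continuousAt_eval_zero (backwardShift Y g)).tendsto.mono_left
          (nhdsWithin_le_nhds (s := {0}ᶜ))
        refine tendsto_nhds_unique h1 (h2.congr' ?_)
        filter_upwards [self_mem_nhdsWithin,
          mem_nhdsWithin_of_mem_nhds (Metric.ball_mem_nhds (0 : ℂ) one_pos)] with z hz0 hz
        exact (hne z hz hz0).symm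
      · exact hne z hz hz0
  exact ext fun n => key n f g h

end HardySpace

/-! ### Unitary colligations: energy balance and the coisometric row -/

/-- A unitary colligation: bounded operators such that `(x, u) ↦ (A x + B u, C x + D u)` is a
unitary operator from `X ⊕ U` to `X ⊕ Y`. -/
structure UnitaryColligation (X U Y : Type*)
    [NormedAddCommGroup X] [InnerProductSpace ℂ X] [CompleteSpace X]
    [NormedAddCommGroup U] [InnerProductSpace ℂ U] [CompleteSpace U]
    [NormedAddCommGroup Y] [InnerProductSpace ℂ Y] [CompleteSpace Y] where
  A : X →L[ℂ] X
  B : U →L[ℂ] X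
  C : X →L[ℂ] Y
  D : U →L[ℂ] Y
  norm_sq_add_norm_sq : ∀ x u, ‖A x + B u‖ ^ 2 + ‖C x + D u‖ ^ 2 = ‖x‖ ^ 2 + ‖u‖ ^ 2
  state_adjoint : ∀ x y, A (C.adjoint y + A.adjoint x) + B (D.adjoint y + B.adjoint x) = x
  output_adjoint : ∀ x y, C (C.adjoint y + A.adjoint x) + D (D.adjoint y + B.adjoint x) = y

namespace UnitaryColligation

open HardySpace

variable {X U Y : Type*}
    [NormedAddCommGroup X] [InnerProductSpace ℂ X] [CompleteSpace X]
    [NormedAddCommGroup U] [InnerProductSpace ℂ U] [CompleteSpace U]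
    [NormedAddCommGroup Y] [InnerProductSpace ℂ Y] [CompleteSpace Y]
    (W : UnitaryColligation X U Y)

/-- The states of the system with initial state `x` and input sequence `g`. -/
def state (x : X) (g : ℕ → U) : ℕ → X
  | 0 => x
  | n + 1 => W.A (state x g n) + W.B (g n)

/-- The outputs of the system with initial state `x` and input sequence `g`. -/
def output (x : X) (g : ℕ → U) (n : ℕ) : Y := W.C (W.state x g n) + W.D (g n)

/-- Time invariance: the recursion defining `state` peels off the last step, whereas prepending a
coefficient with `cons` requires peeling off the first. -/
theorem state_succ' (x : X) (g : ℕ → U) (n : ℕ) :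
    W.state x g (n + 1) = W.state (W.A x + W.B (g 0)) (fun k => g (k + 1)) n := by
  induction n with
  | zero => rfl
  | succ n ih => rw [state, ih]; rfl

theorem state_add (x x' : X) (g g' : ℕ → U) (n : ℕ) :
    W.state (x + x') (g + g') n = W.state x g n + W.state x' g' n := by
  induction n with
  | zero => rfl
  | succ n ih => simp only [state, ih, Pi.add_apply, map_add]; abel

theorem state_smul (c : ℂ) (x : X) (g : ℕ → U) (n : ℕ) :
    W.state (c • x) (c • g) n = c • W.state x g n := by
  induction n with
  | zero => rfl
  | succ n ih => simp only [state, ih, Pi.smul_apply, map_smul, smul_add]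

/-- The isometry identity of the colligation, applied at each time, telescopes. -/
theorem energy_balance (x : X) (g : ℕ → U) (N : ℕ) :
    ‖W.state x g N‖ ^ 2 + ∑ n ∈ Finset.range N, ‖W.output x g n‖ ^ 2 =
      ‖x‖ ^ 2 + ∑ n ∈ Finset.range N, ‖g n‖ ^ 2 := by
  induction N with
  | zero => simp [state]
  | succ N ih =>
    rw [Finset.sum_range_succ, Finset.sum_range_succ]
    have := W.norm_sq_add_norm_sq (W.state x g N) (g N)
    simp only [state, output] at *
    linarith

theorem norm_state_le (x : X) (g : HardySpace U) (N : ℕ) :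
    ‖W.state x g N‖ ^ 2 ≤ ‖x‖ ^ 2 + ‖g‖ ^ 2 := by
  have h := W.energy_balance x g N
  have h1 := sum_norm_sq_le g N
  have : 0 ≤ ∑ n ∈ Finset.range N, ‖W.output x g n‖ ^ 2 := by positivity
  linarith

theorem sum_output_le (x : X) (g : HardySpace U) (N : ℕ) :
    ∑ n ∈ Finset.range N, ‖W.output x g n‖ ^ 2 ≤ ‖x‖ ^ 2 + ‖g‖ ^ 2 := by
  have h := W.energy_balance x g N
  have h1 := sum_norm_sq_le g N
  have : 0 ≤ ‖W.state x g N‖ ^ 2 := by positivity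
  linarith

theorem summable_output (x : X) (g : HardySpace U) :
    Summable fun n => ‖W.output x g n‖ ^ 2 :=
  summable_of_sum_range_le (fun _ => by positivity) (W.sum_output_le x g)

/-- The output of the system as a linear function of the initial state and the input. -/
def outputMap : X × HardySpace U →ₗ[ℂ] HardySpace Y where
  toFun p := ⟨W.output p.1 p.2, memℓp_of_summable (W.summable_output p.1 p.2)⟩
  map_add' p q := by
    ext n
    change W.C (W.state (p.1 + q.1) (⇑p.2 + ⇑q.2) n) + W.D (p.2 n + q.2 n) =
      (W.C (W.state p.1 p.2 n) + W.D (p.2 n)) + (W.C (W.state q.1 q.2 n) + W.D (q.2 n))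
    rw [state_add, map_add, map_add]
    abel
  map_smul' c p := by
    ext n
    change W.C (W.state (c • p.1) (c • ⇑p.2) n) + W.D (c • p.2 n) =
      c • (W.C (W.state p.1 p.2 n) + W.D (p.2 n))
    rw [state_smul, map_smul, map_smul, smul_add]

theorem outputMap_apply (x : X) (g : HardySpace U) (n : ℕ) :
    W.outputMap (x, g) n = W.C (W.state x g n) + W.D (g n) := rfl

theorem norm_outputMap_sq_le (x : X) (g : HardySpace U) :
    ‖W.outputMap (x, g)‖ ^ 2 ≤ ‖x‖ ^ 2 + ‖g‖ ^ 2 := by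
  rw [norm_sq_eq_tsum]
  exact Real.tsum_le_of_sum_range_le (fun _ => by positivity) (W.sum_output_le x g)

theorem outputMap_cons (x : X) (u : U) (g : HardySpace U) :
    W.outputMap (x, cons u g) = cons (W.C x + W.D u) (W.outputMap (W.A x + W.B u, g)) := by
  ext n
  cases n with
  | zero => rfl
  | succ n =>
    rw [outputMap_apply, state_succ']
    rfl

/-- The observability operator `x ↦ ∑ₙ (C Aⁿ x) zⁿ`. -/
noncomputable def observability : X →L[ℂ] HardySpace Y :=
  (W.outputMap ∘ₗ LinearMap.inl ℂ X (HardySpace U)).mkContinuous 1 fun x => by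
    have h := W.norm_outputMap_sq_le x 0
    rw [one_mul]
    exact abs_le_of_sq_le_sq' (by simpa using h) (norm_nonneg _) |>.2

/-- The input-output operator of the system started at the zero state. -/
noncomputable def inputOutput : HardySpace U →L[ℂ] HardySpace Y :=
  (W.outputMap ∘ₗ LinearMap.inr ℂ X (HardySpace U)).mkContinuous 1 fun g => by
    have h := W.norm_outputMap_sq_le 0 g
    rw [one_mul]
    exact abs_le_of_sq_le_sq' (by simpa using h) (norm_nonneg _) |>.2

theorem observability_apply (x : X) : W.observability x = W.outputMap (x, 0) := rfl

theorem inputOutput_apply (g : HardySpace U) : W.inputOutput g = W.outputMap (0, g) := rfl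

theorem observability_add_inputOutput (x : X) (g : HardySpace U) :
    W.observability x + W.inputOutput g = W.outputMap (x, g) := by
  rw [observability_apply, inputOutput_apply, ← map_add]
  simp

theorem norm_observability_add_inputOutput_sq_le (x : X) (g : HardySpace U) :
    ‖W.observability x + W.inputOutput g‖ ^ 2 ≤ ‖x‖ ^ 2 + ‖g‖ ^ 2 := by
  rw [observability_add_inputOutput]
  exact W.norm_outputMap_sq_le x g

theorem state_zero_input (x : X) (n : ℕ) :
    W.state x (⇑(0 : HardySpace U)) n = (W.A ^ n) x := by
  induction n with
  | zero => rfl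
  | succ n ih =>
    rw [state, ih, pow_succ']
    simp

theorem observability_apply_apply (x : X) (n : ℕ) :
    W.observability x n = W.C ((W.A ^ n) x) := by
  rw [observability_apply, outputMap_apply, state_zero_input]
  simp

theorem backwardShift_observability (x : X) :
    backwardShift Y (W.observability x) = W.observability (W.A x) := by
  ext n
  rw [backwardShift_apply, observability_apply_apply, observability_apply_apply, pow_succ]
  rfl

theorem inputOutput_cons (u : U) (g : HardySpace U) :
    W.inputOutput (cons u g) =
      cons (W.D u) (W.observability (W.B u) + W.inputOutput g) := by
  rw [observability_add_inputOutput, inputOutput_apply, outputMap_cons]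
  simp

theorem adjoint_observability_cons (y : Y) (f : HardySpace Y) :
    W.observability.adjoint (cons y f) =
      W.C.adjoint y + W.A.adjoint (W.observability.adjoint f) := by
  refine ext_inner_right ℂ fun x => ?_
  rw [ContinuousLinearMap.adjoint_inner_left, inner_cons_left, inner_add_left,
    ContinuousLinearMap.adjoint_inner_left, ContinuousLinearMap.adjoint_inner_left,
    ContinuousLinearMap.adjoint_inner_left, backwardShift_observability,
    observability_apply_apply]
  rfl

theorem adjoint_inputOutput_cons (y : Y) (f : HardySpace Y) :
    W.inputOutput.adjoint (cons y f) =
      cons (W.D.adjoint y + W.B.adjoint (W.observability.adjoint f))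
        (W.inputOutput.adjoint f) := by
  refine ext_inner_right ℂ fun g => ?_
  rw [ContinuousLinearMap.adjoint_inner_left, ← cons_backwardShift g, inputOutput_cons,
    inner_cons_left, inner_cons_left]
  simp only [cons_apply_zero, backwardShift_cons, inner_add_left, inner_add_right,
    ContinuousLinearMap.adjoint_inner_left]
  ring

/-- The adjoints send `cons y f` to one backward step of the system from the state `O* f` and output
`y`. The next forward step undoes it, because the fields `state_adjoint` and `output_adjoint` say
that the colligation times its adjoint is the identity. -/
theorem observability_adjoint_add_inputOutput_adjoint_cons (y : Y) (f : HardySpace Y) :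
    W.observability (W.observability.adjoint (cons y f)) +
        W.inputOutput (W.inputOutput.adjoint (cons y f)) =
      cons y (W.observability (W.observability.adjoint f) +
        W.inputOutput (W.inputOutput.adjoint f)) := by
  rw [observability_add_inputOutput, observability_add_inputOutput, adjoint_observability_cons,
    adjoint_inputOutput_cons, outputMap_cons, W.state_adjoint, W.output_adjoint]

/-- The row operator formed by the observability operator and the input-output operator is a
coisometry. -/
theorem observability_adjoint_add_inputOutput_adjoint (f : HardySpace Y) :
    W.observability (W.observability.adjoint f) +
      W.inputOutput (W.inputOutput.adjoint f) = f := by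
  have key : ∀ (n : ℕ) (f : HardySpace Y),
      (W.observability (W.observability.adjoint f) +
        W.inputOutput (W.inputOutput.adjoint f)) n = f n := by
    intro n
    induction n with
    | zero =>
      intro f
      rw [← cons_backwardShift f, observability_adjoint_add_inputOutput_adjoint_cons]
      rfl
    | succ n ih =>
      intro f
      rw [← cons_backwardShift f, observability_adjoint_add_inputOutput_adjoint_cons]
      exact ih _
  exact ext fun n => key n f

end UnitaryColligation

/-! ### Ranges and norms for a coisometric row `(V T)` -/

section Coisometry

open ContinuousLinearMap

variable {X G H : Type*}
  [NormedAddCommGroup X] [InnerProductSpace ℂ X] [CompleteSpace X]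
  [NormedAddCommGroup G] [InnerProductSpace ℂ G] [CompleteSpace G]
  [NormedAddCommGroup H] [InnerProductSpace ℂ H] [CompleteSpace H]
  {V : X →L[ℂ] H} {T : G →L[ℂ] H}

theorem denseRange_adjoint_of_injective (hV : Function.Injective V) :
    DenseRange V.adjoint := by
  have h : (LinearMap.range V.adjoint.toLinearMap)ᗮ = ⊥ := by
    rw [Submodule.eq_bot_iff]
    intro x hx
    refine hV ?_
    rw [map_zero]
    refine ext_inner_left ℂ fun k => ?_
    rw [inner_zero_right, ← adjoint_inner_left]
    exact (Submodule.mem_orthogonal _ _).1 hx _ ⟨k, rfl⟩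
  have h' := (Submodule.topologicalClosure_eq_top_iff).2 h
  have := (Submodule.dense_iff_topologicalClosure_eq_top).2 h'
  exact this

variable (hVT : ∀ f, V (V.adjoint f) + T (T.adjoint f) = f)

include hVT in
theorem norm_sq_eq_of_coisometry (k : H) :
    ‖k‖ ^ 2 = ‖V.adjoint k‖ ^ 2 + ‖T.adjoint k‖ ^ 2 := by
  have h1 : RCLike.re (inner ℂ k (V (V.adjoint k) + T (T.adjoint k))) = ‖k‖ ^ 2 := by
    rw [hVT, inner_self_eq_norm_sq]
  rw [inner_add_right, map_add, ← adjoint_inner_left V, ← adjoint_inner_left T,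
    inner_self_eq_norm_sq, inner_self_eq_norm_sq] at h1
  exact h1.symm

include hVT in
-- Expand `‖k - (f + T T* k)‖² ≥ 0` and replace `‖k‖²` by `‖V* k‖² + ‖T* k‖²`.
theorem two_mul_re_inner_sub_le_of_coisometry (f k : H) :
    2 * RCLike.re (inner ℂ k f) - ‖V.adjoint k‖ ^ 2 ≤
      ‖f + T (T.adjoint k)‖ ^ 2 - ‖T.adjoint k‖ ^ 2 := by
  have h1 := norm_sq_eq_of_coisometry hVT k
  have h2 : RCLike.re (inner ℂ k (T (T.adjoint k))) = ‖T.adjoint k‖ ^ 2 := by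
    rw [← adjoint_inner_left, inner_self_eq_norm_sq]
  have h3 := norm_sub_sq (𝕜 := ℂ) k (f + T (T.adjoint k))
  rw [inner_add_right, map_add, h2] at h3
  nlinarith [sq_nonneg ‖k - (f + T (T.adjoint k))‖]

include hVT in
-- With `g = T* k` the previous bound reads `‖x‖² - ‖x - V* k‖²`, and `V* k` can be taken
-- arbitrarily close to `x`.
theorem exists_lt_norm_add_sq_sub_of_coisometry (hV : Function.Injective V) (x : X) {r : ℝ}
    (hr : r < ‖x‖ ^ 2) : ∃ g : G, r < ‖V x + T g‖ ^ 2 - ‖g‖ ^ 2 := by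
  have hc : Continuous fun w : X => 2 * RCLike.re (inner ℂ w x) - ‖w‖ ^ 2 := by fun_prop
  have hopen : IsOpen {w : X | r < 2 * RCLike.re (inner ℂ w x) - ‖w‖ ^ 2} :=
    isOpen_lt continuous_const hc
  obtain ⟨k, hk⟩ := (denseRange_adjoint_of_injective hV).exists_mem_open hopen ⟨x, by
    rw [Set.mem_ofPred_eq, inner_self_eq_norm_sq]
    linarith⟩
  refine ⟨T.adjoint k, lt_of_lt_of_le hk ?_⟩
  rw [adjoint_inner_left]
  exact two_mul_re_inner_sub_le_of_coisometry hVT (V x) k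

include hVT in
-- A Douglas-type argument: scaling `k` turns the upper bound `M` into `|⟨f, k⟩| ≤ √M ‖V* k‖`, so
-- `V* k ↦ ⟨f, k⟩` is a bounded functional on a dense subspace, and its Riesz vector is a preimage
-- of `f`.
theorem mem_range_of_coisometry (hV : Function.Injective V) {f : H} {M : ℝ}
    (hM : ∀ g, ‖f + T g‖ ^ 2 - ‖g‖ ^ 2 ≤ M) : f ∈ Set.range V := by
  have hM0 : 0 ≤ M := by
    have := hM 0
    rw [map_zero, norm_zero] at this
    nlinarith [sq_nonneg ‖f + 0‖]
  have bound : ∀ k, ‖inner ℂ f k‖ ≤ Real.sqrt M * ‖V.adjoint k‖ := by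
    intro k
    set a := inner ℂ k f with ha
    have hak : ‖inner ℂ f k‖ = ‖a‖ := norm_inner_symm f k
    have hq : ∀ t : ℝ, 0 ≤ (‖a‖ ^ 2 * ‖V.adjoint k‖ ^ 2) * (t * t) + (-2 * ‖a‖ ^ 2) * t + M := by
      intro t
      -- The factor `a` aligns the phase, so the inner product with `f` becomes the real number `t
      -- ‖a‖²`; nonnegativity for all real `t` then bounds the discriminant.
      have h := (two_mul_re_inner_sub_le_of_coisometry hVT f (((t : ℂ) * a) • k)).trans (hM _)
      have h1 : inner ℂ (((t : ℂ) * a) • k) f = ((t * ‖a‖ ^ 2 : ℝ) : ℂ) := by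
        rw [inner_smul_left, ← ha, map_mul, Complex.conj_ofReal, mul_assoc,
          Complex.conj_mul']
        push_cast
        ring
      rw [h1, map_smul, norm_smul, norm_mul, Complex.norm_real, mul_pow, mul_pow,
        Real.norm_eq_abs, sq_abs] at h
      have h2 : RCLike.re ((t * ‖a‖ ^ 2 : ℝ) : ℂ) = t * ‖a‖ ^ 2 := Complex.ofReal_re _
      rw [h2] at h
      linarith
    have hd := discrim_le_zero hq
    rw [discrim] at hd
    rw [hak]
    refine (sq_le_sq₀ (norm_nonneg _) (by positivity)).1 ?_
    rw [mul_pow, Real.sq_sqrt hM0]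
    rcases eq_or_ne a 0 with h0 | h0
    · rw [h0, norm_zero, zero_pow two_ne_zero]
      positivity
    · have hpos : 0 < ‖a‖ ^ 2 := by positivity
      refine le_of_mul_le_mul_left ?_ hpos
      linarith
  have hd := denseRange_adjoint_of_injective hV
  let ψ : X →L[ℂ] ℂ := LinearMap.extendOfNorm (innerSL ℂ f).toLinearMap V.adjoint.toLinearMap
  have hψ : ∀ k, ψ (V.adjoint k) = inner ℂ f k := fun k =>
    LinearMap.extendOfNorm_eq (f := (innerSL ℂ f).toLinearMap) (e := V.adjoint.toLinearMap) hd
      ⟨_, bound⟩ k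
  refine ⟨(InnerProductSpace.toDual ℂ X).symm ψ, ext_inner_right ℂ fun k => ?_⟩
  rw [← adjoint_inner_right, InnerProductSpace.toDual_symm_apply, hψ]

end Coisometry

/-! ### The transfer function and the model on `H(S)` -/

namespace UnitaryColligation

open HardySpace

variable {X U Y : Type*}
    [NormedAddCommGroup X] [InnerProductSpace ℂ X] [CompleteSpace X]
    [NormedAddCommGroup U] [InnerProductSpace ℂ U] [CompleteSpace U]
    [NormedAddCommGroup Y] [InnerProductSpace ℂ Y] [CompleteSpace Y]
    (W : UnitaryColligation X U Y)

/-- The transfer function `z ↦ D + z C (1 - z A)⁻¹ B`. -/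
noncomputable def transfer (z : ℂ) : U →L[ℂ] Y :=
  W.D + z • (W.C ∘L Ring.inverse (1 - z • W.A) ∘L W.B)

theorem norm_A_le : ‖W.A‖ ≤ 1 := by
  refine ContinuousLinearMap.opNorm_le_bound _ zero_le_one fun x => ?_
  have h := W.norm_sq_add_norm_sq x 0
  simp only [map_zero, add_zero, norm_zero] at h
  rw [one_mul]
  refine abs_le_of_sq_le_sq' ?_ (norm_nonneg _) |>.2
  nlinarith [sq_nonneg ‖W.C x‖]

theorem isUnit_one_sub_smul_A {z : ℂ} (hz : ‖z‖ < 1) : IsUnit (1 - z • W.A) := by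
  refine isUnit_one_sub_of_norm_lt_one ?_
  rw [norm_smul]
  exact (mul_le_of_le_one_right (norm_nonneg z) W.norm_A_le).trans_lt hz

/-- Replaces the resolvent by any solution of the state equation, which is how both the Schur bound
and the multiplication formula are obtained. -/
theorem transfer_apply_of_eq {z : ℂ} (hz : ‖z‖ < 1) {x : X} {u : U}
    (hx : x = z • (W.A x + W.B u)) : W.transfer z u = W.C x + W.D u := by
  have h1 : (1 - z • W.A) x = z • W.B u := by
    rw [sub_apply, one_apply_eq_self,
      smul_apply, sub_eq_iff_eq_add, ← smul_add, add_comm (W.B u)]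
    exact hx
  have h2 : x = z • Ring.inverse (1 - z • W.A) (W.B u) := by
    rw [← map_smul, ← h1, ← mul_apply_eq_comp,
      Ring.inverse_mul_cancel _ (W.isUnit_one_sub_smul_A hz), one_apply_eq_self]
  rw [add_comm]
  conv_rhs => rw [h2, map_smul]
  rfl

theorem exists_state_eq {z : ℂ} (hz : ‖z‖ < 1) (u : U) :
    ∃ x : X, x = z • (W.A x + W.B u) := by
  refine ⟨z • Ring.inverse (1 - z • W.A) (W.B u), ?_⟩
  have h : (1 - z • W.A) (Ring.inverse (1 - z • W.A) (W.B u)) = W.B u := by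
    rw [← mul_apply_eq_comp,
      Ring.mul_inverse_cancel _ (W.isUnit_one_sub_smul_A hz), one_apply_eq_self]
  rw [sub_apply, one_apply_eq_self,
    smul_apply, sub_eq_iff_eq_add] at h
  rw [map_smul]
  congr 1
  rw [add_comm]
  exact h

theorem isSchur_transfer : IsSchur W.transfer := by
  constructor
  · intro z hz
    have hz' : ‖z‖ < 1 := by simpa using hz
    have h1 : DifferentiableAt ℂ (fun z : ℂ => Ring.inverse (1 - z • W.A)) z :=
      DifferentiableAt.fun_comp' (g := Ring.inverse) z
        (differentiableAt_inverse (W.isUnit_one_sub_smul_A hz')) (by fun_prop)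
    have h2 : DifferentiableAt ℂ W.transfer z := by
      unfold transfer
      exact (differentiableAt_const _).add (differentiableAt_id.fun_smul
        ((differentiableAt_const _).clm_comp (h1.clm_comp (differentiableAt_const _))))
    exact h2.differentiableWithinAt
  · intro z hz
    have hz' : ‖z‖ < 1 := by simpa using hz
    refine ContinuousLinearMap.opNorm_le_bound _ zero_le_one fun u => ?_
    obtain ⟨x, hx⟩ := W.exists_state_eq hz' u
    rw [W.transfer_apply_of_eq hz' hx, one_mul]
    have h := W.norm_sq_add_norm_sq x u
    -- Since `‖z‖ < 1`, the state norm does not decrease, so the isometry identity leaves at most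
    -- `‖u‖` for the output.
    have hle : ‖x‖ ≤ ‖W.A x + W.B u‖ := by
      conv_lhs => rw [hx, norm_smul]
      exact mul_le_of_le_one_left (norm_nonneg _) hz'.le
    refine abs_le_of_sq_le_sq' ?_ (norm_nonneg _) |>.2
    nlinarith [norm_nonneg x]

/-- The generating function of the states turns the recursion into the state equation with input
`g(z)`. It converges because the states are bounded by `‖g‖`. -/
theorem eval_inputOutput (g : HardySpace U) {z : ℂ} (hz : ‖z‖ < 1) :
    eval (W.inputOutput g) z = W.transfer z (eval g z) := by
  have hz' : z ∈ Metric.ball (0 : ℂ) 1 := by simpa using hz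
  set s : ℕ → X := W.state 0 g with hs
  have hsum : Summable fun n => z ^ n • s n := by
    refine Summable.of_norm_bounded (g := fun n : ℕ => ‖z‖ ^ n * ‖g‖)
      ((summable_geometric_of_lt_one (norm_nonneg z) hz).mul_right _) fun n => ?_
    rw [norm_smul, norm_pow]
    refine mul_le_mul_of_nonneg_left ?_ (by positivity)
    refine abs_le_of_sq_le_sq' ?_ (norm_nonneg _) |>.2
    simpa using W.norm_state_le 0 g n
  have hg := (summable_eval g hz').hasSum
  have hB := hg.mapL W.B
  have hA := hsum.hasSum.mapL W.A
  have hx : ∑' n, z ^ n • s n = z • (W.A (∑' n, z ^ n • s n) + W.B (eval g z)) := by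
    conv_lhs => rw [hsum.tsum_eq_zero_add]
    have h1 := (hA.add hB).const_smul z
    have h2 : (fun n => z ^ (n + 1) • s (n + 1)) =
        fun n => z • (W.A (z ^ n • s n) + W.B (z ^ n • g n)) := by
      ext n
      change z ^ (n + 1) • (W.A (s n) + W.B (g n)) = _
      rw [map_smul, map_smul, ← smul_add, smul_smul, pow_succ']
    rw [h2, h1.tsum_eq]
    have h0 : s 0 = 0 := rfl
    rw [h0, smul_zero, zero_add]
    rfl
  rw [W.transfer_apply_of_eq hz hx]
  have h3 := (hsum.hasSum.mapL W.C).add (hg.mapL W.D)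
  refine (HasSum.tsum_eq ?_)
  change HasSum _ (W.C _ + W.D (∑' n : ℕ, z ^ n • g n))
  convert h3 using 2 with n
  change z ^ n • (W.C (s n) + W.D (g n)) = _
  rw [map_smul, map_smul, smul_add]

theorem deBrangesRovnyakValues_transfer (f : HardySpace Y) :
    deBrangesRovnyakValues W.transfer f =
      Set.range fun g => ‖f + W.inputOutput g‖ ^ 2 - ‖g‖ ^ 2 := by
  ext t
  constructor
  · rintro ⟨g, h, hh, rfl⟩
    refine ⟨g, ?_⟩
    have : h = W.inputOutput g := eval_injOn fun z hz => by
      rw [hh z hz, W.eval_inputOutput g (by simpa using hz)]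
    rw [this]
  · rintro ⟨g, rfl⟩
    exact ⟨g, W.inputOutput g, fun z hz => W.eval_inputOutput g (by simpa using hz), rfl⟩

theorem isLUB_deBrangesRovnyakValues (hV : Function.Injective W.observability) (x : X) :
    IsLUB (deBrangesRovnyakValues W.transfer (W.observability x)) (‖x‖ ^ 2) := by
  rw [deBrangesRovnyakValues_transfer]
  constructor
  · rintro _ ⟨g, rfl⟩
    have := W.norm_observability_add_inputOutput_sq_le x g
    simp only
    linarith
  · intro b hb
    by_contra hlt
    obtain ⟨g, hg⟩ := exists_lt_norm_add_sq_sub_of_coisometry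
      W.observability_adjoint_add_inputOutput_adjoint hV x (not_le.1 hlt)
    exact absurd (hb ⟨g, rfl⟩) (not_le.2 hg)

theorem isUnitarilyEquivalentToModel (hV : Function.Injective W.observability) :
    IsUnitarilyEquivalentToModel W.A W.transfer := by
  refine ⟨W.observability.toLinearMap, Set.Subset.antisymm ?_ ?_, fun x => ?_, fun x => ?_⟩
  · rintro _ ⟨x, rfl⟩
    exact ⟨_, (W.isLUB_deBrangesRovnyakValues hV x).1⟩
  · rintro f ⟨M, hM⟩
    refine mem_range_of_coisometry W.observability_adjoint_add_inputOutput_adjoint hV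
      (M := M) fun g => hM ?_
    rw [deBrangesRovnyakValues_transfer]
    exact ⟨g, rfl⟩
  · have hne : (deBrangesRovnyakValues W.transfer (W.observability x)).Nonempty := by
      rw [deBrangesRovnyakValues_transfer]
      exact Set.range_nonempty _
    have h := (W.isLUB_deBrangesRovnyakValues hV x).csSup_eq hne
    change Real.sqrt (sSup (deBrangesRovnyakValues W.transfer (W.observability x))) = ‖x‖
    rw [h, Real.sqrt_sq (norm_nonneg x)]
  · exact (W.backwardShift_observability x).symm

end UnitaryColligation

/-! ### Fourier orthogonality and Parseval on the circle -/

section CircleIntegrals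

variable {E : Type*} [NormedAddCommGroup E] [InnerProductSpace ℂ E]

/-- The value at `z` of the polynomial with coefficients `a 0, …, a (N - 1)`. -/
def polyEval (N : ℕ) (a : ℕ → E) (z : ℂ) : E := ∑ n ∈ Finset.range N, z ^ n • a n

theorem differentiable_polyEval (N : ℕ) (a : ℕ → E) : Differentiable ℂ (polyEval N a) := by
  unfold polyEval
  fun_prop

theorem norm_polyEval_le (N : ℕ) (a : ℕ → E) {z : ℂ} (hz : ‖z‖ ≤ 1) :
    ‖polyEval N a z‖ ≤ ∑ n ∈ Finset.range N, ‖a n‖ := by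
  refine norm_sum_le_of_le _ fun n _ => ?_
  rw [norm_smul, norm_pow]
  exact mul_le_of_le_one_left (norm_nonneg _) (pow_le_one₀ (norm_nonneg z) hz)

theorem continuous_coe_circleExp : Continuous fun θ : ℝ => (Circle.exp θ : ℂ) := by
  fun_prop

theorem continuous_polyEval_circleExp (N : ℕ) (a : ℕ → E) :
    Continuous fun θ : ℝ => polyEval N a (Circle.exp θ) :=
  (differentiable_polyEval N a).continuous.comp continuous_coe_circleExp

theorem integral_mul_circleExp (r : ℝ) [CompleteSpace E] {f : ℂ → E}
    (hf : DifferentiableOn ℂ f (Metric.ball 0 1)) (hr0 : 0 ≤ r) (hr1 : r < 1) :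
    ∫ θ in (0 : ℝ)..2 * Real.pi, f (r * Circle.exp θ) = (2 * Real.pi) • f 0 := by
  have hsub : Metric.closedBall (0 : ℂ) |r| ⊆ Metric.ball 0 1 :=
    Metric.closedBall_subset_ball (by rwa [abs_of_nonneg hr0])
  have h := DiffContOnCl.circleAverage (f := f) (c := 0) (R := r)
    ((hf.mono hsub).diffContOnCl_ball le_rfl)
  rw [Real.circleAverage_def] at h
  have hpi : (2 * Real.pi) ≠ 0 := by positivity
  rw [← h, smul_smul, mul_inv_cancel₀ hpi, one_smul]
  simp only [circleMap, zero_add, Circle.coe_exp]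

theorem integral_conj_circleExp_pow_mul (m n : ℕ) :
    ∫ θ in (0 : ℝ)..2 * Real.pi,
      (starRingEnd ℂ) ((Circle.exp θ : ℂ) ^ n) * (Circle.exp θ : ℂ) ^ m =
      if m = n then (2 * Real.pi : ℂ) else 0 := by
  have h : ∀ θ : ℝ, (starRingEnd ℂ) ((Circle.exp θ : ℂ) ^ n) * (Circle.exp θ : ℂ) ^ m =
      Complex.exp ((((m : ℤ) - n : ℤ) * Complex.I) * θ) := by
    intro θ
    rw [map_pow, Circle.coe_exp, ← Complex.exp_conj, ← Complex.exp_nat_mul,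
      ← Complex.exp_nat_mul, ← Complex.exp_add]
    congr 1
    rw [map_mul, Complex.conj_ofReal, Complex.conj_I]
    push_cast
    ring
  simp only [h]
  split_ifs with hmn
  · simp [hmn]
  · have hc : (((m : ℤ) - n : ℤ) : ℂ) * Complex.I ≠ 0 := by
      refine mul_ne_zero ?_ Complex.I_ne_zero
      rw [Int.cast_ne_zero, sub_ne_zero]
      exact Nat.cast_injective.ne hmn
    rw [integral_exp_mul_complex hc]
    have h1 : Complex.exp ((((m : ℤ) - n : ℤ) * Complex.I) * ((2 * Real.pi : ℝ) : ℂ)) = 1 := by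
      rw [← Complex.exp_int_mul_two_pi_mul_I ((m : ℤ) - n)]
      congr 1
      push_cast
      ring
    rw [h1]
    simp

theorem norm_circleExp_pow_smul (θ : ℝ) (n : ℕ) (a : E) :
    ‖(Circle.exp θ : ℂ) ^ n • a‖ = ‖a‖ := by
  rw [norm_smul, norm_pow, Circle.norm_coe, one_pow, one_mul]

variable [CompleteSpace E]

theorem integral_inner_circleExp_pow_smul_tsum (n : ℕ) (y : E) {a : ℕ → E}
    (ha : Summable fun m => ‖a m‖) :
    ∫ θ in (0 : ℝ)..2 * Real.pi,
      inner ℂ ((Circle.exp θ : ℂ) ^ n • y) (∑' m, (Circle.exp θ : ℂ) ^ m • a m) =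
      2 * Real.pi * inner ℂ y (a n) := by
  have hsum : ∀ θ : ℝ, Summable fun m => (Circle.exp θ : ℂ) ^ m • a m := fun θ =>
    Summable.of_norm (by simpa only [norm_circleExp_pow_smul] using ha)
  have h := intervalIntegral.hasSum_integral_of_dominated_convergence (μ := volume)
    (a := 0) (b := 2 * Real.pi)
    (F := fun m (θ : ℝ) =>
      inner ℂ ((Circle.exp θ : ℂ) ^ n • y) ((Circle.exp θ : ℂ) ^ m • a m))
    (f := fun θ : ℝ =>
      inner ℂ ((Circle.exp θ : ℂ) ^ n • y) (∑' m, (Circle.exp θ : ℂ) ^ m • a m))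
    (fun m _ => ‖y‖ * ‖a m‖)
    (fun m => Continuous.aestronglyMeasurable (by fun_prop))
    (fun m => Eventually.of_forall fun θ _ => by
      refine (norm_inner_le_norm _ _).trans_eq ?_
      rw [norm_circleExp_pow_smul, norm_circleExp_pow_smul])
    (Eventually.of_forall fun _ _ => ha.mul_left _)
    intervalIntegrable_const
    (Eventually.of_forall fun θ _ =>
      (hsum θ).hasSum.mapL (innerSL ℂ ((Circle.exp θ : ℂ) ^ n • y)))
  have h2 : ∀ m, ∫ θ in (0 : ℝ)..2 * Real.pi,
      inner ℂ ((Circle.exp θ : ℂ) ^ n • y) ((Circle.exp θ : ℂ) ^ m • a m) =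
      if m = n then 2 * Real.pi * inner ℂ y (a n) else 0 := by
    intro m
    have hθ : ∀ θ : ℝ, inner ℂ ((Circle.exp θ : ℂ) ^ n • y) ((Circle.exp θ : ℂ) ^ m • a m) =
        (starRingEnd ℂ) ((Circle.exp θ : ℂ) ^ n) * (Circle.exp θ : ℂ) ^ m * inner ℂ y (a m) := by
      intro θ
      rw [inner_smul_left, inner_smul_right, mul_assoc]
    simp only [hθ]
    rw [intervalIntegral.integral_mul_const, integral_conj_circleExp_pow_mul]
    split_ifs with hmn
    · rw [hmn]
    · rw [zero_mul]
  simp only [h2] at h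
  exact h.unique (hasSum_ite_eq n _)

theorem continuous_tsum_circleExp {a : ℕ → E} (ha : Summable fun m => ‖a m‖) :
    Continuous fun θ : ℝ => ∑' m, (Circle.exp θ : ℂ) ^ m • a m :=
  continuous_tsum (fun m => by fun_prop) ha fun m θ => (norm_circleExp_pow_smul θ m (a m)).le

/-- Parseval's identity for a polynomial and an absolutely convergent power series on the unit
circle. -/
theorem integral_inner_polyEval_tsum (N : ℕ) (p : ℕ → E) {a : ℕ → E}
    (ha : Summable fun m => ‖a m‖) :
    ∫ θ in (0 : ℝ)..2 * Real.pi,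
      inner ℂ (polyEval N p (Circle.exp θ)) (∑' m, (Circle.exp θ : ℂ) ^ m • a m) =
      2 * Real.pi * ∑ n ∈ Finset.range N, inner ℂ (p n) (a n) := by
  have hc := continuous_tsum_circleExp ha
  simp only [polyEval, sum_inner]
  rw [intervalIntegral.integral_finsetSum fun n _ => Continuous.intervalIntegrable
    (by fun_prop) _ _, Finset.mul_sum]
  exact Finset.sum_congr rfl fun n _ => integral_inner_circleExp_pow_smul_tsum n (p n) ha

theorem integral_norm_polyEval_sq (N : ℕ) (a : ℕ → E) :
    ∫ θ in (0 : ℝ)..2 * Real.pi, ‖polyEval N a (Circle.exp θ)‖ ^ 2 =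
      2 * Real.pi * ∑ n ∈ Finset.range N, ‖a n‖ ^ 2 := by
  -- Padding the coefficients with zeros makes the polynomial an absolutely convergent series.
  set b : ℕ → E := fun m => if m ∈ Finset.range N then a m else 0 with hb
  have hb0 : ∀ m ∉ Finset.range N, b m = 0 := fun m hm => if_neg hm
  have h := integral_inner_polyEval_tsum N a (a := b)
    (summable_of_ne_finset_zero (s := Finset.range N) fun m hm => by rw [hb0 m hm, norm_zero])
  have h1 : ∀ θ : ℝ, ∑' m, (Circle.exp θ : ℂ) ^ m • b m = polyEval N a (Circle.exp θ) := by
    intro θ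
    rw [tsum_eq_sum (s := Finset.range N) fun m hm => by rw [hb0 m hm, smul_zero]]
    exact Finset.sum_congr rfl fun m hm => by rw [hb]; simp only [if_pos hm]
  have h2 : ∑ n ∈ Finset.range N, inner ℂ (a n) (b n) =
      ((∑ n ∈ Finset.range N, ‖a n‖ ^ 2 : ℝ) : ℂ) := by
    push_cast
    refine Finset.sum_congr rfl fun n hn => ?_
    rw [hb]
    simp only [if_pos hn]
    exact inner_self_eq_norm_sq_to_K _
  simp only [h1, h2, inner_self_eq_norm_sq_to_K] at h
  have h3 : ((∫ θ in (0 : ℝ)..2 * Real.pi, ‖polyEval N a (Circle.exp θ)‖ ^ 2 : ℝ) : ℂ) =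
      ((2 * Real.pi * ∑ n ∈ Finset.range N, ‖a n‖ ^ 2 : ℝ) : ℂ) := by
    rw [← intervalIntegral.integral_ofReal]
    push_cast
    push_cast at h
    exact h
  exact_mod_cast h3

end CircleIntegrals

/-! ### Weak radial limits under the integral sign -/

section RadialLimits

variable {U Y : Type*} [NormedAddCommGroup U] [InnerProductSpace ℂ U]
  [NormedAddCommGroup Y] [InnerProductSpace ℂ Y]
  {F : ℂ → U →L[ℂ] Y} {Fb : Circle → U →L[ℂ] Y}

/-- On the radius `‖rζ - ζ‖ = 1 - r`, so any aperture above `1` would do; `2` is used. -/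
theorem tendsto_radial (ζ : Circle) :
    Tendsto (fun r : ℝ => (r * ζ : ℂ)) (𝓝[<] 1)
      (𝓝[{z : ℂ | ‖z‖ < 1 ∧ ‖z - ζ‖ < 2 * (1 - ‖z‖)}] (ζ : ℂ)) := by
  refine tendsto_nhdsWithin_iff.2 ⟨?_, ?_⟩
  · have h : Continuous fun r : ℝ => (r * ζ : ℂ) := by fun_prop
    have := (h.tendsto 1).mono_left (nhdsWithin_le_nhds (s := Set.Iio 1))
    simpa using this
  · filter_upwards [Ioo_mem_nhdsLT (zero_lt_one' ℝ)] with r hr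
    have h1 : ‖(r * ζ : ℂ)‖ = r := by
      rw [norm_mul, Circle.norm_coe, mul_one, Complex.norm_real, Real.norm_of_nonneg hr.1.le]
    have h2 : ‖(r * ζ : ℂ) - ζ‖ = 1 - r := by
      have : (r * ζ : ℂ) - ζ = ((r - 1 : ℝ) : ℂ) * ζ := by push_cast; ring
      rw [this, norm_mul, Circle.norm_coe, mul_one, Complex.norm_real, Real.norm_eq_abs,
        abs_sub_comm, abs_of_pos (by linarith [hr.2])]
    refine ⟨by rw [h1]; exact hr.2, ?_⟩
    rw [h1, h2]
    linarith [hr.2]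

/-- Weak convergence is assumed on fixed vectors only. A polynomial is a finite combination of fixed
vectors with convergent scalar coefficients, so it may move with `r`. -/
theorem IsBoundaryFunction.tendsto_radial_polyEval (hF : IsBoundaryFunction F Fb) (N : ℕ)
    (g : ℕ → U) : ∀ᵐ θ : ℝ, ∀ y : Y,
      Tendsto (fun r : ℝ => inner ℂ y (F (r * Circle.exp θ) (polyEval N g (r * Circle.exp θ))))
        (𝓝[<] 1) (𝓝 (inner ℂ y (Fb (Circle.exp θ) (polyEval N g (Circle.exp θ))))) := by
  filter_upwards [hF] with θ hθ y
  simp only [polyEval, map_sum, map_smul, inner_sum, inner_smul_right]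
  refine tendsto_finsetSum _ fun k _ => ?_
  refine Tendsto.mul ?_ ((hθ 2 (g k) y).comp (tendsto_radial (Circle.exp θ)))
  exact (((tendsto_radial (Circle.exp θ)).mono_right nhdsWithin_le_nhds).pow k)

theorem IsSchur.continuous_radial (hF : IsSchur F) {G : ℂ → U} (hG : Continuous G) {r : ℝ}
    (hr : r ∈ Set.Ioo (0 : ℝ) 1) :
    Continuous fun θ : ℝ => F (r * Circle.exp θ) (G (r * Circle.exp θ)) := by
  have h1 : Continuous fun θ : ℝ => (r * Circle.exp θ : ℂ) := by fun_prop
  refine (hF.1.continuousOn.comp_continuous h1 fun θ => ?_).clm_apply (hG.comp h1)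
  rw [mem_ball_zero_iff, norm_mul, Circle.norm_coe, mul_one, Complex.norm_real,
    Real.norm_of_nonneg hr.1.le]
  exact hr.2

theorem norm_radial_lt {r : ℝ} (hr : r ∈ Set.Ioo (0 : ℝ) 1) (ζ : Circle) :
    ‖(r * ζ : ℂ)‖ < 1 := by
  rw [norm_mul, Circle.norm_coe, mul_one, Complex.norm_real, Real.norm_of_nonneg hr.1.le]
  exact hr.2

theorem IsSchur.norm_inner_radial_le (hF : IsSchur F) (N : ℕ) (g : ℕ → U) (y : Y) {r : ℝ}
    (hr : r ∈ Set.Ioo (0 : ℝ) 1) (ζ : Circle) :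
    ‖(inner ℂ y (F (r * ζ) (polyEval N g (r * ζ))) : ℂ)‖ ≤
      ‖y‖ * ∑ n ∈ Finset.range N, ‖g n‖ := by
  have hz := norm_radial_lt hr ζ
  refine (norm_inner_le_norm _ _).trans (mul_le_mul_of_nonneg_left ?_ (norm_nonneg _))
  refine (((F (r * ζ)).le_opNorm _).trans (mul_le_of_le_one_left (norm_nonneg _)
    (hF.2 _ (by simpa using hz)))).trans (norm_polyEval_le N g hz.le)

theorem IsSchur.tendsto_integral_radial (hF : IsSchur F) (hFb : IsBoundaryFunction F Fb)
    (N : ℕ) (g : ℕ → U) {p : ℝ → Y} (hp : Continuous p) :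
    Tendsto (fun r : ℝ => ∫ θ in (0 : ℝ)..2 * Real.pi,
        (inner ℂ (p θ) (F (r * Circle.exp θ) (polyEval N g (r * Circle.exp θ))) : ℂ)) (𝓝[<] 1)
      (𝓝 (∫ θ in (0 : ℝ)..2 * Real.pi,
        (inner ℂ (p θ) (Fb (Circle.exp θ) (polyEval N g (Circle.exp θ))) : ℂ))) := by
  have hev : ∀ᶠ r : ℝ in 𝓝[<] 1, r ∈ Set.Ioo (0 : ℝ) 1 := Ioo_mem_nhdsLT zero_lt_one
  refine intervalIntegral.tendsto_integral_filter_of_dominated_convergence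
    (fun θ => ‖p θ‖ * ∑ n ∈ Finset.range N, ‖g n‖) ?_ ?_ ?_ ?_
  · filter_upwards [hev] with r hr
    exact (hp.inner (hF.continuous_radial (differentiable_polyEval N g).continuous
      hr)).aestronglyMeasurable
  · filter_upwards [hev] with r hr
    exact Eventually.of_forall fun θ _ => hF.norm_inner_radial_le N g (p θ) hr _
  · exact Continuous.intervalIntegrable (by fun_prop) _ _
  · filter_upwards [hFb.tendsto_radial_polyEval N g] with θ hθ _
    exact hθ (p θ)

/-- Measurability comes from a sequence of radii tending to `1`, and the bound by an integrable
function survives the limit. -/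
theorem IsSchur.intervalIntegrable_boundary (hF : IsSchur F) (hFb : IsBoundaryFunction F Fb)
    (N : ℕ) (g : ℕ → U) {p : ℝ → Y} (hp : Continuous p) :
    IntervalIntegrable (fun θ : ℝ =>
      (inner ℂ (p θ) (Fb (Circle.exp θ) (polyEval N g (Circle.exp θ))) : ℂ)) volume
      0 (2 * Real.pi) := by
  have hev : ∀ᶠ r : ℝ in 𝓝[<] 1, r ∈ Set.Ioo (0 : ℝ) 1 := Ioo_mem_nhdsLT zero_lt_one
  obtain ⟨s, hs⟩ := exists_seq_tendsto (𝓝[<] (1 : ℝ))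
  -- Dropping the first `k` radii places all the others in `(0, 1)`.
  obtain ⟨k, hk⟩ := (hs.eventually hev).exists_forall_of_atTop
  have hlim := hFb.tendsto_radial_polyEval N g
  have hmeas : AEStronglyMeasurable (fun θ : ℝ =>
      (inner ℂ (p θ) (Fb (Circle.exp θ) (polyEval N g (Circle.exp θ))) : ℂ)) volume := by
    refine aestronglyMeasurable_of_tendsto_ae (u := atTop)
      (f := fun i (θ : ℝ) => (inner ℂ (p θ) (F (s (i + k) * Circle.exp θ)
        (polyEval N g (s (i + k) * Circle.exp θ))) : ℂ)) (fun i => ?_) ?_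
    · exact (hp.inner (hF.continuous_radial (differentiable_polyEval N g).continuous
        (hk _ (Nat.le_add_left k i)))).aestronglyMeasurable
    · filter_upwards [hlim] with θ hθ
      exact ((hθ (p θ)).comp hs).comp (tendsto_add_atTop_nat k)
  have hb : IntervalIntegrable (fun θ => ‖p θ‖ * ∑ n ∈ Finset.range N, ‖g n‖) volume
      0 (2 * Real.pi) := Continuous.intervalIntegrable (by fun_prop) _ _
  refine hb.mono_fun hmeas.restrict (ae_restrict_of_ae ?_)
  filter_upwards [hlim] with θ hθ
  refine le_of_tendsto (hθ (p θ)).norm ?_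
  filter_upwards [hev] with r hr
  exact (hF.norm_inner_radial_le N g (p θ) hr _).trans (le_abs_self _)

end RadialLimits

/-! ### The unitary colligation of a contraction -/

section DefectOperator

open ContinuousLinearMap

variable {X : Type*} [NormedAddCommGroup X] [InnerProductSpace ℂ X] [CompleteSpace X]
  (A : X →L[ℂ] X)

/-- The defect operator `(1 - A* A)^(1/2)`. -/
noncomputable def defectOperator : X →L[ℂ] X := CFC.sqrt (1 - A.adjoint * A)

variable {A} (hA : ‖A‖ ≤ 1)

include hA in
theorem norm_sq_add_norm_defectOperator_sq (x : X) :
    ‖A x‖ ^ 2 + ‖defectOperator A x‖ ^ 2 = ‖x‖ ^ 2 := by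
  have hAA : ∀ x, RCLike.re (inner ℂ ((A.adjoint * A) x) x) = ‖A x‖ ^ 2 := fun x => by
    rw [mul_apply_eq_comp, adjoint_inner_left, inner_self_eq_norm_sq]
  have hpos : (0 : X →L[ℂ] X) ≤ 1 - A.adjoint * A := by
    rw [nonneg_iff_isPositive]
    refine ⟨?_, fun x => ?_⟩
    · exact ((IsSelfAdjoint.one _).sub (IsSelfAdjoint.star_mul_self A)).isSymmetric
    · rw [reApplyInnerSelf_apply, sub_apply, inner_sub_left, map_sub, hAA, one_apply_eq_self,
        inner_self_eq_norm_sq, sub_nonneg]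
      exact pow_le_pow_left₀ (norm_nonneg _) (A.le_of_opNorm_le hA x |>.trans_eq (one_mul _)) 2
  have hsa : IsSelfAdjoint (defectOperator A) := IsSelfAdjoint.of_nonneg (CFC.sqrt_nonneg _)
  have hsq : defectOperator A * defectOperator A = 1 - A.adjoint * A :=
    CFC.sqrt_mul_sqrt_self _ hpos
  have h : RCLike.re (inner ℂ ((defectOperator A * defectOperator A) x) x) =
      ‖defectOperator A x‖ ^ 2 := by
    have h := adjoint_inner_left (defectOperator A) x (defectOperator A x)
    rw [hsa.adjoint_eq] at h
    rw [mul_apply_eq_comp, h, inner_self_eq_norm_sq]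
  rw [hsq, sub_apply, inner_sub_left, map_sub, hAA, one_apply_eq_self,
    inner_self_eq_norm_sq] at h
  linarith

/-- The isometry `x ↦ (A x, (1 - A* A)^(1/2) x)`. -/
noncomputable def defectIsometry : X →ₗᵢ[ℂ] WithLp 2 (X × X) where
  toLinearMap := (WithLp.linearEquiv 2 ℂ (X × X)).symm.toLinearMap ∘ₗ
    (A.toLinearMap.prod (defectOperator A).toLinearMap)
  norm_map' x := by
    refine (sq_eq_sq₀ (norm_nonneg _) (norm_nonneg _)).1 ?_
    rw [WithLp.prod_norm_sq_eq_of_L2]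
    exact norm_sq_add_norm_defectOperator_sq hA x

/-- The input space of the colligation of a contraction. -/
noncomputable abbrev defectInputSpace : Submodule ℂ (WithLp 2 (X × X)) :=
  (LinearMap.range (defectIsometry hA).toLinearMap)ᗮ

noncomputable def defectInputState : defectInputSpace hA →L[ℂ] X :=
  WithLp.fstL 2 ℂ X X ∘L (defectInputSpace hA).subtypeL

noncomputable def defectInputOutput : defectInputSpace hA →L[ℂ] X :=
  WithLp.sndL 2 ℂ X X ∘L (defectInputSpace hA).subtypeL

/-- Split `(x, y)` along the closed range of the defect isometry and its complement. The adjoints of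
the coordinate operators return exactly the two components, which gives the coisometry half of
unitarity. -/
theorem exists_defect_decomposition (x y : X) :
    ∃ (a : X) (w : defectInputSpace hA), A a + defectInputState hA w = x ∧
      defectOperator A a + defectInputOutput hA w = y ∧
      (defectOperator A).adjoint y + A.adjoint x = a ∧
      (defectInputOutput hA).adjoint y + (defectInputState hA).adjoint x = w := by
  let e : WithLp 2 (X × X) := WithLp.toLp 2 (x, y)
  have hcl : IsClosed (LinearMap.range (defectIsometry hA).toLinearMap : Set (WithLp 2 (X × X))) :=
    (defectIsometry hA).isometry.isClosedEmbedding.isClosed_range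
  have : CompleteSpace (LinearMap.range (defectIsometry hA).toLinearMap) :=
    hcl.completeSpace_coe
  obtain ⟨_, ⟨a, rfl⟩, w, hw, hsum⟩ :=
    Submodule.exists_add_mem_mem_orthogonal
      (K := LinearMap.range (defectIsometry hA).toLinearMap) e
  have hinner : ∀ v : WithLp 2 (X × X), inner ℂ y v.snd + inner ℂ x v.fst = inner ℂ e v := by
    intro v
    rw [WithLp.prod_inner_apply, add_comm]
    rfl
  have h1 : x = A a + w.fst := congrArg WithLp.fst hsum
  have h2 : y = defectOperator A a + w.snd := congrArg WithLp.snd hsum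
  refine ⟨a, ⟨w, hw⟩, h1.symm, h2.symm, ?_, ?_⟩
  · refine ext_inner_right ℂ fun v => ?_
    rw [inner_add_left, adjoint_inner_left, adjoint_inner_left]
    refine (hinner (defectIsometry hA v)).trans ?_
    have h0 : inner ℂ w (defectIsometry hA v) = 0 :=
      (Submodule.mem_orthogonal' _ _).1 hw _ ⟨v, rfl⟩
    rw [hsum, inner_add_left, h0, add_zero]
    exact (defectIsometry hA).inner_map_map a v
  · refine ext_inner_right ℂ fun v => ?_
    rw [inner_add_left, adjoint_inner_left, adjoint_inner_left]
    refine (hinner v).trans ?_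
    rw [hsum, inner_add_left, (Submodule.mem_orthogonal _ _).1 v.2 _ ⟨a, rfl⟩, zero_add]
    rfl

/-- The unitary colligation with state operator a given contraction and output operator its
defect operator. -/
noncomputable def defectColligation : UnitaryColligation X (defectInputSpace hA) X where
  A := A
  B := defectInputState hA
  C := defectOperator A
  D := defectInputOutput hA
  norm_sq_add_norm_sq x u := by
    have h0 : inner ℂ (defectIsometry hA x) (u : WithLp 2 (X × X)) = 0 :=
      (Submodule.mem_orthogonal _ _).1 u.2 _ ⟨x, rfl⟩
    have h := norm_add_sq_eq_norm_sq_add_norm_sq_of_inner_eq_zero _ _ h0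
    rw [← sq, ← sq, ← sq, (defectIsometry hA).norm_map, WithLp.prod_norm_sq_eq_of_L2] at h
    exact h
  state_adjoint x y := by
    obtain ⟨a, w, h1, _, h3, h4⟩ := exists_defect_decomposition hA x y
    rw [h3, h4, h1]
  output_adjoint x y := by
    obtain ⟨a, w, _, h2, h3, h4⟩ := exists_defect_decomposition hA x y
    rw [h3, h4, h2]

/-- If the output vanishes, the defect operator kills every `Aⁿ x`, so no step loses norm. -/
theorem injective_observability_defectColligation
    (hA' : (⋂ n : ℕ, {x : X | ‖(A ^ n) x‖ = ‖x‖}) = {0}) :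
    Function.Injective (defectColligation hA).observability := by
  rw [injective_iff_map_eq_zero]
  intro x hx
  have hC : ∀ n, defectOperator A ((A ^ n) x) = 0 := by
    intro n
    have h := (defectColligation hA).observability_apply_apply x n
    rw [hx] at h
    exact h.symm
  have hn : ∀ n, ‖(A ^ n) x‖ = ‖x‖ := by
    intro n
    induction n with
    | zero => simp
    | succ n ih =>
      have h := norm_sq_add_norm_defectOperator_sq hA ((A ^ n) x)
      rw [hC, norm_zero, zero_pow two_ne_zero, add_zero] at h
      rw [← ih, pow_succ', mul_apply_eq_comp]
      exact (sq_eq_sq₀ (norm_nonneg _) (norm_nonneg _)).1 h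
  have : x ∈ (⋂ n : ℕ, {x : X | ‖(A ^ n) x‖ = ‖x‖}) := Set.mem_iInter.2 hn
  rw [hA'] at this
  exact this

end DefectOperator

/-! ### Norm inequality forced by a factorable minorant -/

section FactorableMinorant

variable {U Y Y₀ : Type*}
  [NormedAddCommGroup U] [InnerProductSpace ℂ U]
  [NormedAddCommGroup Y] [InnerProductSpace ℂ Y] [CompleteSpace Y]
  [NormedAddCommGroup Y₀] [InnerProductSpace ℂ Y₀]
  {S : ℂ → U →L[ℂ] Y} {Φ Ψ : ℂ → U →L[ℂ] Y₀}
  {Sb : Circle → U →L[ℂ] Y} {Φb : Circle → U →L[ℂ] Y₀}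

theorem tendsto_pow_nhdsLT_one (n : ℕ) : Tendsto (fun r : ℝ => (r : ℂ) ^ n) (𝓝[<] 1) (𝓝 1) := by
  have h : Continuous fun r : ℝ => (r : ℂ) ^ n := by fun_prop
  have := (h.tendsto 1).mono_left (nhdsWithin_le_nhds (s := Set.Iio 1))
  simpa using this

/-- At radius `r` the coefficients of `S g` are `rᵐ hₘ`; Parseval gives `∑ rⁿ ‖hₙ‖²`, and `r → 1`.
-/
theorem IsSchur.integral_inner_boundary_coefficients (hS : IsSchur S)
    (hSb : IsBoundaryFunction S Sb) (K : ℕ) (g : ℕ → U) {h : HardySpace Y}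
    (hh : ∀ z ∈ Metric.ball (0 : ℂ) 1, h.eval z = S z (polyEval K g z)) (N : ℕ) :
    ∫ θ in (0 : ℝ)..2 * Real.pi, (inner ℂ (polyEval N (⇑h) (Circle.exp θ))
      (Sb (Circle.exp θ) (polyEval K g (Circle.exp θ))) : ℂ) =
      2 * Real.pi * ((∑ n ∈ Finset.range N, ‖h n‖ ^ 2 : ℝ) : ℂ) := by
  refine tendsto_nhds_unique (hS.tendsto_integral_radial hSb K g
    (continuous_polyEval_circleExp N (⇑h))) ?_
  have hlim : Tendsto (fun r : ℝ =>
      2 * Real.pi * ∑ n ∈ Finset.range N, (r : ℂ) ^ n * ((‖h n‖ ^ 2 : ℝ) : ℂ)) (𝓝[<] 1)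
      (𝓝 (2 * Real.pi * ∑ n ∈ Finset.range N, 1 * ((‖h n‖ ^ 2 : ℝ) : ℂ))) :=
    (tendsto_finsetSum _ fun n _ => (tendsto_pow_nhdsLT_one n).mul_const _).const_mul _
  simp only [one_mul] at hlim
  rw [Complex.ofReal_sum]
  refine hlim.congr' ?_
  filter_upwards [Ioo_mem_nhdsLT (zero_lt_one' ℝ)] with r hr
  have hr1 : ‖(r : ℂ)‖ < 1 := by
    rw [Complex.norm_real, Real.norm_of_nonneg hr.1.le]
    exact hr.2
  have hval : ∀ θ : ℝ, S (r * Circle.exp θ) (polyEval K g (r * Circle.exp θ)) =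
      ∑' m, (Circle.exp θ : ℂ) ^ m • ((r : ℂ) ^ m • h m) := by
    intro θ
    rw [← hh _ (by simpa using norm_radial_lt hr (Circle.exp θ))]
    refine tsum_congr fun m => ?_
    rw [smul_smul, mul_pow, mul_comm]
  simp only [hval]
  rw [integral_inner_polyEval_tsum N (⇑h) (h.summable_norm_eval hr1)]
  congr 1
  refine Finset.sum_congr rfl fun n _ => ?_
  rw [inner_smul_right, inner_self_eq_norm_sq_to_K]
  push_cast
  rfl

/-- Pairing with `ζⁿ y` cancels `zⁿ` up to `rⁿ`; the mean value property evaluates the rest. -/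
theorem IsSchur.integral_inner_boundary_of_eq_pow_smul (hΦ : IsSchur Φ)
    (hΦb : IsBoundaryFunction Φ Φb) {n : ℕ} (hΨ : DifferentiableOn ℂ Ψ (Metric.ball 0 1))
    (hΦΨ : ∀ z ∈ Metric.ball (0 : ℂ) 1, Φ z = z ^ n • Ψ z) (K : ℕ) (g : ℕ → U) (y : Y₀) :
    ∫ θ in (0 : ℝ)..2 * Real.pi, (inner ℂ ((Circle.exp θ : ℂ) ^ n • y)
      (Φb (Circle.exp θ) (polyEval K g (Circle.exp θ))) : ℂ) =
      2 * Real.pi * inner ℂ y (Ψ 0 (polyEval K g 0)) := by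
  refine tendsto_nhds_unique (hΦ.tendsto_integral_radial hΦb K g
    (p := fun θ => (Circle.exp θ : ℂ) ^ n • y) (by fun_prop)) ?_
  have hlim := (tendsto_pow_nhdsLT_one n).mul_const
    (2 * Real.pi * inner ℂ y (Ψ 0 (polyEval K g 0)))
  rw [one_mul] at hlim
  refine hlim.congr' ?_
  filter_upwards [Ioo_mem_nhdsLT (zero_lt_one' ℝ)] with r hr
  have hval : ∀ θ : ℝ, (inner ℂ ((Circle.exp θ : ℂ) ^ n • y)
      (Φ (r * Circle.exp θ) (polyEval K g (r * Circle.exp θ))) : ℂ) =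
      (r : ℂ) ^ n * inner ℂ y (Ψ (r * Circle.exp θ) (polyEval K g (r * Circle.exp θ))) := by
    intro θ
    have h1 : (starRingEnd ℂ) ((Circle.exp θ : ℂ) ^ n) * (Circle.exp θ : ℂ) ^ n = 1 := by
      rw [Complex.conj_mul', norm_pow, Circle.norm_coe]
      simp
    rw [hΦΨ _ (by simpa using norm_radial_lt hr (Circle.exp θ)), smul_apply,
      inner_smul_left, inner_smul_right, mul_pow]
    linear_combination ((r : ℂ) ^ n *
      inner ℂ y (Ψ (r * Circle.exp θ) (polyEval K g (r * Circle.exp θ)))) * h1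
  simp only [hval]
  rw [intervalIntegral.integral_const_mul]
  have hd : DifferentiableOn ℂ (fun z => (inner ℂ y (Ψ z (polyEval K g z)) : ℂ))
      (Metric.ball 0 1) :=
    (innerSL ℂ y).differentiable.comp_differentiableOn
      (hΨ.clm_apply (differentiable_polyEval K g).differentiableOn)
  rw [integral_mul_circleExp r hd hr.1.le hr.2]
  congr 1
  rw [Complex.real_smul]
  push_cast
  rfl

variable [CompleteSpace U] [CompleteSpace Y₀]

theorem norm_sq_add_norm_sq_le_of_adjoint_comp_le {P : U →L[ℂ] Y₀} {Q : U →L[ℂ] Y}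
    (h : P.adjoint ∘L P ≤ ContinuousLinearMap.id ℂ U - Q.adjoint ∘L Q) (v : U) :
    ‖P v‖ ^ 2 + ‖Q v‖ ^ 2 ≤ ‖v‖ ^ 2 := by
  have h1 := ((ContinuousLinearMap.le_def _ _).1 h).re_inner_nonneg_left v
  have hP : RCLike.re (inner ℂ ((P.adjoint ∘L P) v) v) = ‖P v‖ ^ 2 := by
    rw [ContinuousLinearMap.comp_apply, ContinuousLinearMap.adjoint_inner_left,
      inner_self_eq_norm_sq]
  have hQ : RCLike.re (inner ℂ ((Q.adjoint ∘L Q) v) v) = ‖Q v‖ ^ 2 := by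
    rw [ContinuousLinearMap.comp_apply, ContinuousLinearMap.adjoint_inner_left,
      inner_self_eq_norm_sq]
  rw [sub_apply, sub_apply, inner_sub_left, inner_sub_left, map_sub, map_sub, hP, hQ,
    ContinuousLinearMap.id_apply, inner_self_eq_norm_sq] at h1
  linarith

/-- Boundary values are only weak limits, so their squared norms are never integrated: this lower
bound involves them through one inner product with a test vector. -/
theorem two_mul_re_inner_sub_le_norm_sq {E : Type*} [NormedAddCommGroup E]
    [InnerProductSpace ℂ E] (x y : E) : 2 * (inner ℂ x y : ℂ).re - ‖x‖ ^ 2 ≤ ‖y‖ ^ 2 := by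
  have h := norm_sub_sq (𝕜 := ℂ) x y
  have h' : RCLike.re (inner ℂ x y : ℂ) = (inner ℂ x y : ℂ).re := rfl
  rw [h'] at h
  nlinarith [sq_nonneg ‖x - y‖]

/-- A factorable minorant of `1 - S* S` bounds from below the loss of norm under multiplication
by `S`. -/
theorem sum_norm_sq_add_norm_sq_le (hS : IsSchur S) (hSb : IsBoundaryFunction S Sb)
    (hΦ : IsSchur Φ) (hΦb : IsBoundaryFunction Φ Φb)
    (hle : ∀ᵐ θ : ℝ, (Φb (Circle.exp θ)).adjoint ∘L Φb (Circle.exp θ) ≤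
      ContinuousLinearMap.id ℂ U - (Sb (Circle.exp θ)).adjoint ∘L Sb (Circle.exp θ))
    {n : ℕ} (hΨ : DifferentiableOn ℂ Ψ (Metric.ball 0 1))
    (hΦΨ : ∀ z ∈ Metric.ball (0 : ℂ) 1, Φ z = z ^ n • Ψ z) (K : ℕ) (g : ℕ → U)
    {h : HardySpace Y}
    (hh : ∀ z ∈ Metric.ball (0 : ℂ) 1, h.eval z = S z (polyEval K g z)) (N : ℕ) :
    ∑ i ∈ Finset.range N, ‖h i‖ ^ 2 + ‖Ψ 0 (polyEval K g 0)‖ ^ 2 ≤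
      ∑ k ∈ Finset.range K, ‖g k‖ ^ 2 := by
  set y := Ψ 0 (polyEval K g 0) with hy
  have hq : Continuous fun θ : ℝ => (Circle.exp θ : ℂ) ^ n • y := by fun_prop
  have hp := continuous_polyEval_circleExp N (⇑h)
  have hG := continuous_polyEval_circleExp K g
  have i1 := hS.intervalIntegrable_boundary hSb K g hp
  have i2 := hΦ.intervalIntegrable_boundary hΦb K g hq
  have e1 := hS.integral_inner_boundary_coefficients hSb K g hh N
  have e2 := hΦ.integral_inner_boundary_of_eq_pow_smul hΦb hΨ hΦΨ K g y
  rw [← hy, inner_self_eq_norm_sq_to_K] at e2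
  have r1 := Complex.reCLM.intervalIntegral_comp_comm i1
  have r2 := Complex.reCLM.intervalIntegral_comp_comm i2
  rw [e1] at r1
  rw [e2] at r2
  have j1 : IntervalIntegrable (fun θ : ℝ => (inner ℂ (polyEval N (⇑h) (Circle.exp θ))
      (Sb (Circle.exp θ) (polyEval K g (Circle.exp θ))) : ℂ).re) volume 0 (2 * Real.pi) :=
    ⟨i1.1.re, i1.2.re⟩
  have j2 : IntervalIntegrable (fun θ : ℝ => (inner ℂ ((Circle.exp θ : ℂ) ^ n • y)
      (Φb (Circle.exp θ) (polyEval K g (Circle.exp θ))) : ℂ).re) volume 0 (2 * Real.pi) :=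
    ⟨i2.1.re, i2.2.re⟩
  have c1 : IntervalIntegrable (fun θ : ℝ => ‖polyEval N (⇑h) (Circle.exp θ)‖ ^ 2) volume
      0 (2 * Real.pi) := Continuous.intervalIntegrable (by fun_prop) _ _
  have c2 : IntervalIntegrable (fun θ : ℝ => ‖polyEval K g (Circle.exp θ)‖ ^ 2) volume
      0 (2 * Real.pi) := Continuous.intervalIntegrable (by fun_prop) _ _
  have c3 : IntervalIntegrable (fun _ : ℝ => ‖y‖ ^ 2) volume 0 (2 * Real.pi) :=
    intervalIntegrable_const
  -- The test functions are the partial sum of `h` and `ζⁿ y`. For these the integrals of `2 Re ⟨p,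
  -- ·⟩ - ‖p‖²` are exactly `2π` times the two terms on the left of the claim.
  have hmono := intervalIntegral.integral_mono_ae (by positivity : (0 : ℝ) ≤ 2 * Real.pi)
    (((j1.const_mul 2).sub c1).add ((j2.const_mul 2).sub c3)) c2 (by
      filter_upwards [hle] with θ hθ
      have h1 := norm_sq_add_norm_sq_le_of_adjoint_comp_le hθ (polyEval K g (Circle.exp θ))
      have h2 := two_mul_re_inner_sub_le_norm_sq (polyEval N (⇑h) (Circle.exp θ))
        (Sb (Circle.exp θ) (polyEval K g (Circle.exp θ)))
      have h3 := two_mul_re_inner_sub_le_norm_sq ((Circle.exp θ : ℂ) ^ n • y)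
        (Φb (Circle.exp θ) (polyEval K g (Circle.exp θ)))
      rw [norm_circleExp_pow_smul] at h3
      linarith)
  rw [intervalIntegral.integral_add ((j1.const_mul 2).sub c1) ((j2.const_mul 2).sub c3),
    intervalIntegral.integral_sub (j1.const_mul 2) c1,
    intervalIntegral.integral_sub (j2.const_mul 2) c3,
    intervalIntegral.integral_const_mul, intervalIntegral.integral_const_mul,
    intervalIntegral.integral_const, integral_norm_polyEval_sq, integral_norm_polyEval_sq] at hmono
  have r1' : ∫ θ in (0 : ℝ)..2 * Real.pi, (inner ℂ (polyEval N (⇑h) (Circle.exp θ))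
      (Sb (Circle.exp θ) (polyEval K g (Circle.exp θ))) : ℂ).re =
      2 * Real.pi * ∑ i ∈ Finset.range N, ‖h i‖ ^ 2 := by
    refine r1.trans ?_
    rw [Complex.reCLM_apply]
    exact_mod_cast Complex.ofReal_re _
  have r2' : ∫ θ in (0 : ℝ)..2 * Real.pi, (inner ℂ ((Circle.exp θ : ℂ) ^ n • y)
      (Φb (Circle.exp θ) (polyEval K g (Circle.exp θ))) : ℂ).re =
      2 * Real.pi * ‖y‖ ^ 2 := by
    refine r2.trans ?_
    have h2 : (2 * Real.pi : ℂ) * (‖y‖ : ℂ) ^ 2 = ((2 * Real.pi * ‖y‖ ^ 2 : ℝ) : ℂ) := by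
      push_cast
      rfl
    exact (congrArg Complex.re h2).trans (Complex.ofReal_re _)
  rw [r1', r2', smul_eq_mul, sub_zero] at hmono
  have hpi : 0 < 2 * Real.pi := by positivity
  refine le_of_mul_le_mul_left ?_ hpi
  linarith

end FactorableMinorant

/-! ### Taylor truncation and zeros of infinite order -/

namespace HardySpace

variable {U : Type*} [NormedAddCommGroup U] [InnerProductSpace ℂ U]

/-- The Taylor polynomial of degree less than `K`. -/
noncomputable def truncate (K : ℕ) (g : HardySpace U) : HardySpace U :=
  ∑ k ∈ Finset.range K, lp.single 2 k (g k)

theorem tendsto_truncate (g : HardySpace U) :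
    Tendsto (fun K => truncate K g) atTop (𝓝 g) :=
  (lp.hasSum_single (by norm_num) g).tendsto_sum_nat

theorem truncate_apply (K : ℕ) (g : HardySpace U) (n : ℕ) :
    truncate K g n = if n ∈ Finset.range K then g n else 0 := by
  rw [truncate, lp.coeFn_sum, Finset.sum_apply]
  simp only [lp.single_apply, Pi.single_apply, Finset.sum_ite_eq]

theorem eval_truncate (K : ℕ) (g : HardySpace U) (z : ℂ) :
    eval (truncate K g) z = polyEval K (⇑g) z := by
  unfold eval
  rw [tsum_eq_sum (s := Finset.range K) fun m hm => by
    rw [truncate_apply, if_neg hm, smul_zero]]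
  exact Finset.sum_congr rfl fun m hm => by rw [truncate_apply, if_pos hm]

theorem polyEval_zero {K : ℕ} (hK : 0 < K) (a : ℕ → U) : polyEval K a 0 = a 0 := by
  unfold polyEval
  rw [Finset.sum_eq_single_of_mem 0 (Finset.mem_range.2 hK) fun n _ hn => by simp [hn]]
  simp

theorem norm_sq_le_of_sum_range_le {f : HardySpace U} {c : ℝ}
    (h : ∀ N, ∑ n ∈ Finset.range N, ‖f n‖ ^ 2 ≤ c) : ‖f‖ ^ 2 ≤ c := by
  rw [norm_sq_eq_tsum]
  exact Real.tsum_le_of_sum_range_le (fun _ => by positivity) h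

end HardySpace

/-- The hypothesis lets one divide by `z` again and again, so `f` has infinite order at `0` and the
identity theorem applies. -/
theorem eqOn_zero_of_forall_eq_pow_smul {E : Type*} [NormedAddCommGroup E] [NormedSpace ℂ E]
    [CompleteSpace E] {f : ℂ → E} (hf : DifferentiableOn ℂ f (Metric.ball 0 1))
    (h : ∀ (n : ℕ) (k : ℂ → E), DifferentiableOn ℂ k (Metric.ball 0 1) →
      (∀ z ∈ Metric.ball (0 : ℂ) 1, f z = z ^ n • k z) → k 0 = 0) :
    ∀ z ∈ Metric.ball (0 : ℂ) 1, f z = 0 := by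
  have hnhds : Metric.ball (0 : ℂ) 1 ∈ 𝓝 (0 : ℂ) := Metric.ball_mem_nhds _ one_pos
  have key : ∀ n : ℕ, ∃ k : ℂ → E, DifferentiableOn ℂ k (Metric.ball 0 1) ∧
      ∀ z ∈ Metric.ball (0 : ℂ) 1, f z = z ^ n • k z := by
    intro n
    induction n with
    | zero => exact ⟨f, hf, fun z _ => by simp⟩
    | succ n ih =>
      obtain ⟨k, hk, hfk⟩ := ih
      refine ⟨dslope k 0, (Complex.differentiableOn_dslope hnhds).2 hk, fun z hz => ?_⟩
      have hz' := sub_smul_dslope k 0 z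
      rw [sub_zero, h n k hk hfk, sub_zero] at hz'
      rw [hfk z hz, pow_succ, mul_smul, hz']
  have han : AnalyticOnNhd ℂ f (Metric.ball 0 1) := hf.analyticOnNhd Metric.isOpen_ball
  have h0 : AnalyticAt ℂ f 0 := han 0 (by simp)
  have htop : analyticOrderAt f 0 = ⊤ := by
    refine ENat.eq_top_iff_forall_ge.2 fun n => ?_
    obtain ⟨k, hk, hfk⟩ := key n
    refine (natCast_le_analyticOrderAt h0).2 ⟨k, hk.analyticAt hnhds, ?_⟩
    filter_upwards [hnhds] with z hz
    rw [sub_zero]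
    exact hfk z hz
  exact han.eqOn_zero_of_preconnected_of_eventuallyEq_zero
    (convex_ball (0 : ℂ) 1).isPreconnected (by simp) (analyticOrderAt_eq_top.1 htop)

/-! ### Vanishing of the minorant and conclusion -/

namespace UnitaryColligation

open HardySpace

/-- The transfer function of an observable unitary colligation has zero maximal factorable
minorant. -/
theorem hasZeroMaximalFactorableMinorant {X : Type*} {U Y : Type u}
    [NormedAddCommGroup X] [InnerProductSpace ℂ X] [CompleteSpace X]
    [NormedAddCommGroup U] [InnerProductSpace ℂ U] [CompleteSpace U]
    [NormedAddCommGroup Y] [InnerProductSpace ℂ Y] [CompleteSpace Y]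
    (W : UnitaryColligation X U Y) (hV : Function.Injective W.observability) :
    HasZeroMaximalFactorableMinorant W.transfer := by
  intro Y₀ _ _ _ _ Φ Sb Φb hΦ hSb hΦb hle
  refine eqOn_zero_of_forall_eq_pow_smul hΦ.1 fun n Ψ hΨ hΦΨ => ?_
  have key : ∀ g : HardySpace U, ‖W.inputOutput g‖ ^ 2 + ‖Ψ 0 (g 0)‖ ^ 2 ≤ ‖g‖ ^ 2 := by
    intro g
    -- The inequality is known for polynomial inputs. Truncating at `K > 0` keeps `g 0`, and
    -- continuity of `T` gives the general case.
    have hK : ∀ᶠ K in atTop, ‖W.inputOutput (truncate K g)‖ ^ 2 + ‖Ψ 0 (g 0)‖ ^ 2 ≤ ‖g‖ ^ 2 := by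
      filter_upwards [eventually_gt_atTop 0] with K hK
      rw [← le_sub_iff_add_le]
      refine norm_sq_le_of_sum_range_le fun N => ?_
      have h := sum_norm_sq_add_norm_sq_le W.isSchur_transfer hSb hΦ hΦb hle hΨ hΦΨ K (⇑g)
        (h := W.inputOutput (truncate K g)) (fun z hz => by
          rw [W.eval_inputOutput _ (by simpa using hz), eval_truncate]) N
      rw [polyEval_zero hK] at h
      have h' := sum_norm_sq_le g K
      linarith
    have hlim := ((((W.inputOutput.continuous.tendsto g).comp
      (tendsto_truncate g)).norm.pow 2).add_const (‖Ψ 0 (g 0)‖ ^ 2))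
    exact le_of_tendsto hlim hK
  ext u
  rw [zero_apply, ← norm_eq_zero, ← sq_eq_zero_iff]
  refine le_antisymm (le_of_forall_pos_le_add fun ε hε => ?_) (by positivity)
  -- For the input `u + z g`, the loss of norm is within `ε` of `‖u‖² - ‖D u‖² - ‖B u‖²`, which is
  -- zero by the isometry identity at `x = 0`.
  obtain ⟨g, hg⟩ := exists_lt_norm_add_sq_sub_of_coisometry
    W.observability_adjoint_add_inputOutput_adjoint hV (W.B u) (sub_lt_self (‖W.B u‖ ^ 2) hε)
  have h1 := key (cons u g)
  rw [inputOutput_cons, norm_cons_sq, norm_cons_sq, cons_apply_zero] at h1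
  have h2 := W.norm_sq_add_norm_sq 0 u
  simp only [map_zero, zero_add, norm_zero] at h2
  linarith

end UnitaryColligation

theorem theorem3p11 {X : Type u} [NormedAddCommGroup X] [InnerProductSpace ℂ X]
    [CompleteSpace X] [TopologicalSpace.SeparableSpace X]
    (A : X →L[ℂ] X) (hA : IsCompletelyNonIsometricContraction A) :
    ∃ (U Y : Type u)
      (_ : NormedAddCommGroup U) (_ : InnerProductSpace ℂ U) (_ : CompleteSpace U)
      (_ : TopologicalSpace.SeparableSpace U)
      (_ : NormedAddCommGroup Y) (_ : InnerProductSpace ℂ Y) (_ : CompleteSpace Y)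
      (_ : TopologicalSpace.SeparableSpace Y)
      (S : ℂ → U →L[ℂ] Y),
      IsSchur S ∧ IsUnitarilyEquivalentToModel A S ∧ HasZeroMaximalFactorableMinorant S := by
  obtain ⟨hA1, hA2⟩ := hA
  have hV := injective_observability_defectColligation hA1 hA2
  have : SecondCountableTopology X := UniformSpace.secondCountable_of_separable X
  have : TopologicalSpace.SeparableSpace (defectInputSpace hA1) := inferInstance
  exact ⟨defectInputSpace hA1, X, inferInstance, inferInstance, inferInstance, this,
    inferInstance, inferInstance, inferInstance, inferInstance, (defectColligation hA1).transfer,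
    (defectColligation hA1).isSchur_transfer,
    (defectColligation hA1).isUnitarilyEquivalentToModel hV,
    (defectColligation hA1).hasZeroMaximalFactorableMinorant hV⟩
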